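/- Let $X$ be a real Banach space with topological dual $X^*$ (with the norm topology) and duality pairing $\langle\cdot,\cdot\rangle$, let $D\subseteq X$ be non-empty, convex and compact, and let $f:X\to X^*$ be continuous and affine. Let $K:D\to 2^X$ and $F:X\to 2^{X^*}$ be set-valued maps, put $K(D)=\bigcup_{d\in D}K(d)$ and $\bar B(0,\rho)=\{z\in X:\|z\|\le\rho\}$, and suppose: (i) $K$ is lower semicontinuous with non-empty convex values and closed graph; (ii) on $\mathrm{conv}(K(D))$, $F$ has non-empty, convex, compact values, is upper semicontinuous, and is pseudomonotone, i.e. for all $x,y\in\mathrm{conv}(K(D))$, if $\langle x^*,y-x\rangle\ge 0$ for some $x^*\in F(x)$, then $\langle y^*,y-x\rangle\ge 0$ for all $y^*\in F(y)$; (iii) (coercivity condition $(\bar C_d)$ at each $d\in D$) for every $d\in D$ there is $r_d>0$ such that for every $x\in K(d)\setminus\bar B(0,r_d)$ there is $y\in K(d)$ with $\|y\|<\|x\|$ and $\langle x^*,x-y\rangle\ge 0$ for all $x^*\in F(x)$; (iv) for such a choice of radii $(r_d)_{d\in D}$, there is a real number $r>\sup\{r_d:d\in D\}$ such that $K(D)\cap\bar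 B(0,r)$ is compact and $K(d)\cap\bar B(0,r)$ is non-empty for every $d\in D$. (The values of $K$ may be unbounded.) Then the quasi-variational inequality $\mathrm{QVI}(F,f,K)$ has a solution: there exist $\tilde d\in D$, $\tilde x\in K(\tilde d)$ and $\tilde x^*\in F(\tilde x)$ such that $$\langle f(\tilde x),d-\tilde d\rangle+\langle\tilde x^*,z-\tilde x\rangle\ge 0\qquad\text{for all }(d,z)\in D\times K(\tilde d).$$ -/

import Mathlib

/-- A set-valued map `T : X → 2^{X*}` is pseudomonotone on `s` if, for all `x, y ∈ s`, as soon as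
`⟨x*, y - x⟩ ≥ 0` for some `x* ∈ T x`, one has `⟨y*, y - x⟩ ≥ 0` for every `y* ∈ T y`. -/
def IsPseudomonotoneOn {X : Type*} [NormedAddCommGroup X] [NormedSpace ℝ X]
    (T : X → Set (StrongDual ℝ X)) (s : Set X) : Prop :=
  ∀ x ∈ s, ∀ y ∈ s, (∃ x' ∈ T x, 0 ≤ x' (y - x)) → ∀ y' ∈ T y, 0 ≤ y' (y - x)

/-- The pair `(d₀, x₀)` solves the quasi-variational inequality `QVI(F, f, K)`: `d₀ ∈ D`,
`x₀ ∈ K d₀`, and there is `x* ∈ F x₀` with `⟨f x₀, d - d₀⟩ + ⟨x*, z - x₀⟩ ≥ 0` for all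
`(d, z) ∈ D × K d₀`. -/
def IsQVISolution {X : Type*} [NormedAddCommGroup X] [NormedSpace ℝ X] {D : Set X}
    (F : X → Set (StrongDual ℝ X)) (f : X → StrongDual ℝ X) (K : D → Set X)
    (d₀ : D) (x₀ : X) : Prop :=
  x₀ ∈ K d₀ ∧ ∃ x' ∈ F x₀, ∀ d : D, ∀ z ∈ K d₀,
    0 ≤ f x₀ ((d : X) - (d₀ : X)) + x' (z - x₀)

/-- The radius `ρ > 0` witnesses the coercivity condition `(C̄_d)` at `d`: every
`x ∈ K d` outside the closed ball of radius `ρ` admits some `y ∈ K d` with `‖y‖ < ‖x‖` and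
`⟨x*, x - y⟩ ≥ 0` for all `x* ∈ F x`. -/
def IsCoercivityRadius {X : Type*} [NormedAddCommGroup X] [NormedSpace ℝ X] {D : Set X}
    (F : X → Set (StrongDual ℝ X)) (K : D → Set X) (d : D) (ρ : ℝ) : Prop :=
  0 < ρ ∧ ∀ x ∈ K d \ Metric.closedBall (0 : X) ρ,
    ∃ y ∈ K d, ‖y‖ < ‖x‖ ∧ ∀ x' ∈ F x, 0 ≤ x' (x - y)

/-! Truncate each K(d) by the closed ball of radius r. Coercivity does two jobs: it puts a point of
K(d) in the open ball, which keeps the truncated map lower hemicontinuous, and it lets a solution of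
the truncated problem be tested against all of K(d).

The truncated problem is solved by a fixed point of (d, x) ↦ (minimisers of f(x) over D) × (weak
Stampacchia solutions over the truncated K(d)). `kakutani_fan` applies: solutions exist by
`exists_stampacchia_solution`, they form a convex set by Minty's lemma (where pseudomonotonicity
enters), and their graph is closed by the semicontinuity of K and F. At the fixed point, Sion's
minimax theorem replaces functionals depending on the test point by a single one.

Kakutani–Fan follows from Brouwer by partitions of unity, and Brouwer from the no-retraction theorem
by a volume argument: with g = retraction − id, the integral of det(1 + t Dg) over the ball is
polynomial in t and constant for small t ≥ 0, yet zero at t = 1. -/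

/-! ### Brouwer's theorem by the volume argument -/

section Brouwer

open MeasureTheory Metric Set

/-- The polynomial `t ↦ det (1 + t A)` of degree at most `dim E` is determined by its values at
`dim E + 1` nodes, with interpolation weights that do not depend on `A`. -/
theorem exists_weights_det_one_add (E : Type*) [NormedAddCommGroup E] [NormedSpace ℝ E]
    [FiniteDimensional ℝ E] (s : Fin (Module.finrank ℝ E + 1) → ℝ) (hs : Function.Injective s) :
    ∃ w : Fin (Module.finrank ℝ E + 1) → ℝ, ∑ j, w j = 1 ∧
      ∀ A : E →L[ℝ] E, (1 + A).det = ∑ j, w j * (1 + s j • A).det := by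
  classical
  refine ⟨fun j => (Lagrange.basis Finset.univ s j).eval 1, ?_, fun A => ?_⟩
  · rw [← Polynomial.eval_finsetSum, Lagrange.sum_basis hs.injOn Finset.univ_nonempty,
      Polynomial.eval_one]
  · set b := Module.finBasis ℝ E
    set M := LinearMap.toMatrix b b (A : E →ₗ[ℝ] E) with hM
    set p : Polynomial ℝ := Matrix.det ((Polynomial.X : Polynomial ℝ) • M.map Polynomial.C +
      (1 : Matrix _ _ ℝ).map Polynomial.C) with hp
    have heval : ∀ t : ℝ, (1 + t • A).det = p.eval t := by
      intro t
      rw [hp, ← Polynomial.coe_evalRingHom, RingHom.map_det, ContinuousLinearMap.det,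
        ← LinearMap.det_toMatrix b]
      congr 1
      ext i j
      simp [hM, LinearMap.toMatrix_apply, Matrix.one_apply, Finsupp.single_apply, eq_comm,
        add_comm]
      split_ifs <;> simp [mul_comm]
    have hdeg : p.degree < (Finset.univ : Finset (Fin (Module.finrank ℝ E + 1))).card := by
      rw [Finset.card_univ, Fintype.card_fin]
      refine lt_of_le_of_lt Polynomial.degree_le_natDegree ?_
      have := Polynomial.natDegree_det_X_add_C_le M 1
      rw [Fintype.card_fin] at this
      exact_mod_cast Nat.lt_succ_of_le this
    have h1 := heval 1
    rw [one_smul] at h1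
    rw [h1, Lagrange.eq_interpolate hs.injOn hdeg, Lagrange.interpolate_apply,
      Polynomial.eval_finsetSum]
    refine Finset.sum_congr rfl fun j _ => ?_
    rw [Polynomial.eval_mul, Polynomial.eval_C, heval, mul_comm]

variable {E : Type*} [NormedAddCommGroup E]

theorem norm_inv_max_smul_le [NormedSpace ℝ E] (x : E) : ‖(max 1 ‖x‖)⁻¹ • x‖ ≤ 1 := by
  have h : 0 < max 1 ‖x‖ := lt_max_of_lt_left one_pos
  rw [norm_smul, norm_inv, Real.norm_of_nonneg h.le, inv_mul_le_iff₀ h, mul_one]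
  exact le_max_right _ _

/-- The radial retraction onto the closed unit ball is Lipschitz. -/
theorem lipschitzWith_radialRetraction [NormedSpace ℝ E] :
    LipschitzWith 2 fun x : E => (max 1 ‖x‖)⁻¹ • x := by
  refine LipschitzWith.of_dist_le_mul fun x y => ?_
  rw [dist_eq_norm, dist_eq_norm]
  set a := max 1 ‖x‖ with ha
  set b := max 1 ‖y‖ with hb
  have ha1 : 1 ≤ a := le_max_left _ _
  have hb1 : 1 ≤ b := le_max_left _ _
  have ha0 : 0 < a := by linarith
  have hb0 : 0 < b := by linarith
  have hab : |b - a| ≤ ‖x - y‖ := by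
    refine (abs_max_sub_max_le_max _ _ _ _).trans ?_
    rw [sub_self, abs_zero, max_eq_right (abs_nonneg _), norm_sub_rev x y]
    exact abs_norm_sub_norm_le _ _
  have hyb : ‖b⁻¹ • y‖ ≤ 1 := norm_inv_max_smul_le y
  have hinv : a⁻¹ ≤ 1 := inv_le_one_of_one_le₀ ha1
  -- The factor a⁻¹ is at most 1, and each of the two summands has norm at most ‖x - y‖; hence the
  -- constant 2.
  have heq : a⁻¹ • x - b⁻¹ • y = a⁻¹ • ((x - y) + (b - a) • (b⁻¹ • y)) := by
    rw [sub_smul, smul_inv_smul₀ hb0.ne', smul_add, smul_sub, smul_sub, inv_smul_smul₀ ha0.ne']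
    abel
  rw [heq, norm_smul, Real.norm_of_nonneg (inv_nonneg.2 ha0.le)]
  have h2 : ‖(x - y) + (b - a) • (b⁻¹ • y)‖ ≤ 2 * ‖x - y‖ := by
    refine (norm_add_le _ _).trans ?_
    rw [norm_smul, Real.norm_eq_abs]
    nlinarith [abs_nonneg (b - a), norm_nonneg (b⁻¹ • y)]
  calc a⁻¹ * ‖(x - y) + (b - a) • (b⁻¹ • y)‖ ≤ 1 * ‖(x - y) + (b - a) • (b⁻¹ • y)‖ := by gcongr
    _ ≤ _ := by rw [one_mul]; exact_mod_cast h2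

/-- Continuity of the determinant at the identity. It removes the absolute value from the change of
variables formula, uniformly over the ball. -/
theorem exists_det_one_add_pos (E : Type*) [NormedAddCommGroup E] [NormedSpace ℝ E]
    [FiniteDimensional ℝ E] : ∃ δ > 0, ∀ A : E →L[ℝ] E, ‖A‖ < δ → 0 < (1 + A).det := by
  have hc : Continuous fun A : E →L[ℝ] E => (1 + A).det :=
    ContinuousLinearMap.continuous_det.comp (continuous_const.add continuous_id)
  have h0 : (0 : ℝ) < (1 + (0 : E →L[ℝ] E)).det := by
    rw [add_zero]
    simp [ContinuousLinearMap.det]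
  obtain ⟨δ, hδ, h⟩ := Metric.eventually_nhds_iff.1 (hc.continuousAt.eventually_const_lt h0)
  exact ⟨δ, hδ, fun A hA => h (by simpa using hA)⟩

/-- A small Lipschitz perturbation of the identity of the closed unit ball that vanishes on the
sphere and keeps the ball invariant permutes the ball. -/
theorem bijOn_closedBall_add_smul [NormedSpace ℝ E] [CompleteSpace E] {g : E → E} {L : NNReal}
    (hg : LipschitzOnWith L g (closedBall 0 1)) (h0 : ∀ x, ‖x‖ = 1 → g x = 0) {t : NNReal}
    (ht : t * (L * 2) < 1) (hmaps : MapsTo (fun x => x + (t : ℝ) • g x) (closedBall 0 1)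
      (closedBall 0 1)) :
    BijOn (fun x => x + (t : ℝ) • g x) (closedBall 0 1) (closedBall 0 1) := by
  -- Extends g by zero: outside the ball the retraction lands on the sphere, where g vanishes.
  set G : E → E := fun x => g ((max 1 ‖x‖)⁻¹ • x) with hG
  have hGg : ∀ x ∈ closedBall (0 : E) 1, G x = g x := by
    intro x hx
    rw [mem_closedBall_zero_iff] at hx
    simp [hG, max_eq_left hx]
  have hG0 : ∀ x ∉ closedBall (0 : E) 1, G x = 0 := by
    intro x hx
    rw [mem_closedBall_zero_iff, not_le] at hx
    refine h0 _ ?_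
    rw [max_eq_right hx.le, norm_smul, norm_inv, norm_norm]
    exact inv_mul_cancel₀ (by linarith)
  have hGL : LipschitzWith (L * 2) G := by
    rw [← lipschitzOnWith_univ]
    exact hg.comp lipschitzWith_radialRetraction.lipschitzOnWith
      fun x _ => mem_closedBall_zero_iff.2 (norm_inv_max_smul_le x)
  have hcontr : ∀ y : E, ContractingWith (t * (L * 2)) fun x => y - (t : ℝ) • G x := by
    intro y
    refine ⟨ht, LipschitzWith.of_dist_le_mul fun x x' => ?_⟩
    have := hGL.dist_le_mul x x'
    rw [dist_eq_norm] at this ⊢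
    rw [sub_sub_sub_cancel_left, ← smul_sub, norm_smul, norm_sub_rev (G x'), Real.norm_of_nonneg t.coe_nonneg,
      NNReal.coe_mul, mul_assoc]
    exact mul_le_mul_of_nonneg_left this t.2
  refine ⟨hmaps, fun x hx x' hx' hxx' => ?_, fun y hy => ?_⟩
  · dsimp only at hxx'
    rw [← hGg x hx, ← hGg x' hx'] at hxx'
    refine (hcontr (x + (t : ℝ) • G x)).fixedPoint_unique' (x := x) (y := x') ?_ ?_
    · simp [Function.IsFixedPt]
    · simp [Function.IsFixedPt, hxx']
  -- A fixed point of x ↦ y - t G x is a preimage of y; outside the ball it would equal y, which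
  -- lies inside.
  · obtain ⟨x, hx, -⟩ := (hcontr y).exists_fixedPoint y (edist_ne_top _ _)
    have hx' : x + (t : ℝ) • G x = y := (sub_eq_iff_eq_add.1 hx.eq).symm
    by_cases hxB : x ∈ closedBall (0 : E) 1
    · exact ⟨x, hxB, by rw [← hx', hGg x hxB]⟩
    · rw [hG0 x hxB, smul_zero, add_zero] at hx'
      exact absurd (hx' ▸ hy) hxB

/-- There is no `C¹` retraction of the closed unit ball onto the unit sphere. -/
theorem no_contDiff_retraction [InnerProductSpace ℝ E] [FiniteDimensional ℝ E] (r : E → E)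
    (hr : ∀ x ∈ closedBall (0 : E) 1, ContDiffAt ℝ 1 r x)
    (h1 : ∀ x ∈ closedBall (0 : E) 1, ‖r x‖ = 1) (h2 : ∀ x, ‖x‖ = 1 → r x = x) : False := by
  borelize E
  set B := closedBall (0 : E) 1 with hB
  have hBc : IsCompact B := isCompact_closedBall _ _
  have hBm : MeasurableSet B := hBc.measurableSet
  have hBconv : Convex ℝ B := convex_closedBall _ _
  set g : E → E := fun x => r x - x with hg
  have hgC : ∀ x ∈ B, ContDiffAt ℝ 1 g x := fun x hx => (hr x hx).sub contDiffAt_id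
  have hgd : ∀ x ∈ B, DifferentiableAt ℝ g x := fun x hx => (hgC x hx).differentiableAt (by simp)
  have hcont : ContinuousOn (fderiv ℝ g) B := fun x hx =>
    ((hgC x hx).continuousAt_fderiv (by simp)).continuousWithinAt
  obtain ⟨C, hC⟩ := hBc.exists_bound_of_continuousOn hcont
  set L : NNReal := ⟨max C 0, le_max_right _ _⟩ with hL
  have hCL : ∀ x ∈ B, ‖fderiv ℝ g x‖ ≤ L := fun x hx => (hC x hx).trans (le_max_left _ _)
  have hgL : LipschitzOnWith L g B :=
    hBconv.lipschitzOnWith_of_nnnorm_fderiv_le hgd fun x hx => hCL x hx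
  obtain ⟨δ, hδ, hdet⟩ := exists_det_one_add_pos E
  -- The bound with `L * 2` makes the perturbation a contraction; the one with δ keeps the Jacobian
  -- positive.
  obtain ⟨ε, hε, hε1, hεL, hεδ⟩ : ∃ ε : ℝ, 0 < ε ∧ ε ≤ 1 ∧ ε * (L * 2) < 1 ∧ ε * L < δ := by
    have hL0 : (0 : ℝ) ≤ L := L.2
    refine ⟨min 1 (min 1 δ / (2 * L + 2)), by positivity, min_le_left _ _, ?_, ?_⟩
    · calc min 1 (min 1 δ / (2 * L + 2)) * (L * 2) ≤ 1 / (2 * L + 2) * (L * 2) := by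
            gcongr
            refine (min_le_right _ _).trans ?_
            gcongr
            exact min_le_left _ _
        _ < 1 := by rw [div_mul_eq_mul_div, div_lt_one (by positivity)]; linarith
    · calc min 1 (min 1 δ / (2 * L + 2)) * L ≤ δ / (2 * L + 2) * L := by
            gcongr
            refine (min_le_right _ _).trans ?_
            gcongr
            exact min_le_right _ _
        _ < δ := by
          rw [div_mul_eq_mul_div, div_lt_iff₀ (by positivity)]
          nlinarith
  have hvol : ∀ t : ℝ, 0 ≤ t → t ≤ ε →
      ∫ x in B, (1 + t • fderiv ℝ g x).det = volume.real B := by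
    intro t ht0 htε
    have hbij : BijOn (fun x => x + t • g x) B B := by
      refine bijOn_closedBall_add_smul (t := ⟨t, ht0⟩) hgL (fun x hx => ?_) ?_ fun x hx => ?_
      · simp [hg, h2 x hx]
      · rw [← NNReal.coe_lt_coe]
        push_cast
        exact lt_of_le_of_lt (mul_le_mul_of_nonneg_right htε
          (mul_nonneg L.2 zero_le_two)) hεL
      · have : x + t • g x = (1 - t) • x + t • r x := by simp only [hg]; module
        change x + t • g x ∈ B
        rw [this]
        exact hBconv hx (mem_closedBall_zero_iff.2 (h1 x hx).le) (by linarith) ht0 (by ring)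
    have hder : ∀ x ∈ B, HasFDerivWithinAt (fun x => x + t • g x) (1 + t • fderiv ℝ g x) B x :=
      fun x hx => ((hasFDerivAt_id x).add
        ((hgd x hx).hasFDerivAt.const_smul t)).hasFDerivWithinAt
    have hint := integral_image_eq_integral_abs_det_fderiv_smul volume hBm hder hbij.injOn
      fun _ => (1 : ℝ)
    rw [hbij.image_eq] at hint
    simp only [smul_eq_mul, mul_one, integral_const, measureReal_restrict_apply_univ] at hint
    rw [hint]
    refine setIntegral_congr_fun hBm fun x hx => (abs_of_pos (hdet _ ?_)).symm
    rw [norm_smul, Real.norm_of_nonneg ht0]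
    refine lt_of_le_of_lt ?_ hεδ
    exact mul_le_mul htε (hCL x hx) (norm_nonneg _) hε.le
  -- Differentiating ‖r‖² = 1 shows that the range of Dr(x) is orthogonal to r(x) ≠ 0, so Dr(x) is
  -- not surjective.
  have hzero : ∀ x ∈ B, (1 + fderiv ℝ g x).det = 0 := by
    intro x hx
    have hrd : HasFDerivAt r (1 + fderiv ℝ g x) x := by
      have := (hasFDerivAt_id x).add (hgd x hx).hasFDerivAt
      refine this.congr_of_eventuallyEq (Filter.Eventually.of_forall fun y => ?_)
      simp [hg]
    have hort : ∀ v, inner ℝ (r x) ((1 + fderiv ℝ g x) v) = 0 := by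
      intro v
      have hns := (hrd.norm_sq).hasFDerivWithinAt (s := B)
      have hcst : HasFDerivWithinAt (fun y => ‖r y‖ ^ 2) (0 : E →L[ℝ] ℝ) B x :=
        (hasFDerivWithinAt_const (1 : ℝ) x B).congr (fun y hy => by simp [h1 y hy])
          (by simp [h1 x hx])
      have huniq : UniqueDiffWithinAt ℝ B x :=
        uniqueDiffOn_convex hBconv (by rw [hB, interior_closedBall _ one_ne_zero]; simp) x hx
      have := congrArg (fun φ : E →L[ℝ] ℝ => φ v) (huniq.eq hns hcst)
      simpa [inner_add_right, ← mul_add] using this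
    by_contra hne
    have hsurj : Function.Surjective ⇑(1 + fderiv ℝ g x : E →L[ℝ] E) := by
      have hu : IsUnit ((1 + fderiv ℝ g x : E →L[ℝ] E) : E →ₗ[ℝ] E) :=
        LinearMap.isUnit_iff_isUnit_det _ |>.2 (isUnit_iff_ne_zero.2 hne)
      exact ((Module.End.isUnit_iff _).1 hu).2
    obtain ⟨v, hv⟩ := hsurj (r x)
    have := hort v
    rw [hv, inner_self_eq_zero] at this
    have h := h1 x hx
    rw [this, norm_zero] at h
    exact zero_ne_one h
  -- Distinct nodes in (0, ε], where `hvol` applies; interpolation carries the volume identity to t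
  -- = 1.
  set s : Fin (Module.finrank ℝ E + 1) → ℝ := fun j => ε / (j + 1) with hs
  have hsinj : Function.Injective s := by
    intro i j hij
    simp only [hs] at hij
    rw [div_eq_div_iff (by positivity) (by positivity)] at hij
    have := mul_left_cancel₀ hε.ne' hij
    have h3 : ((j : ℕ) : ℝ) = (i : ℕ) := by linarith
    exact (Fin.ext (by exact_mod_cast h3)).symm
  obtain ⟨w, hw, hwdet⟩ := exists_weights_det_one_add E s hsinj
  have hinteg : ∀ t : ℝ, IntegrableOn (fun x => (1 + t • fderiv ℝ g x).det) B := fun t =>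
    (ContinuousLinearMap.continuous_det.comp_continuousOn
      (continuousOn_const.add (hcont.const_smul t))).integrableOn_compact hBc
  have hfin : (0 : ℝ) = volume.real B := by
    calc (0 : ℝ) = ∫ x in B, (1 + fderiv ℝ g x).det := by
          rw [setIntegral_congr_fun hBm hzero, integral_zero]
      _ = ∫ x in B, ∑ j, w j * (1 + s j • fderiv ℝ g x).det :=
          setIntegral_congr_fun hBm fun x _ => hwdet _
      _ = ∑ j, ∫ x in B, w j * (1 + s j • fderiv ℝ g x).det :=
          integral_finsetSum _ fun j _ => (hinteg (s j)).const_mul _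
      _ = ∑ j, w j * volume.real B := by
          refine Finset.sum_congr rfl fun j _ => ?_
          rw [integral_const_mul, hvol (s j) (by positivity)
            (div_le_self hε.le (by linarith [(Nat.cast_nonneg (α := ℝ) (j : ℕ))]))]
      _ = volume.real B := by rw [← Finset.sum_mul, hw, one_mul]
  have hpos : 0 < volume.real B :=
    ENNReal.toReal_pos (measure_closedBall_pos volume 0 one_pos).ne' hBc.measure_lt_top.ne
  exact hpos.ne hfin

/-- Brouwer's theorem for smooth maps. -/
theorem brouwer_contDiff [InnerProductSpace ℝ E] [FiniteDimensional ℝ E] (p : E → E)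
    (hp : ContDiff ℝ 1 p) (hmaps : ∀ x, ‖x‖ ≤ 1 → ‖p x‖ ≤ 1) : ∃ x, ‖x‖ ≤ 1 ∧ p x = x := by
  by_contra! hne
  set w : E → E := fun x => x - p x with hw
  have hwC : ContDiff ℝ 1 w := contDiff_id.sub hp
  have hw0 : ∀ x, ‖x‖ ≤ 1 → 0 < ‖w x‖ ^ 2 := fun x hx => by
    have : w x ≠ 0 := sub_ne_zero.2 (hne x hx).symm
    positivity
  -- A quarter of the discriminant of ‖x + S w‖² = 1 in S. The larger root gives the exit point of
  -- the ray from p(x) through x; Δ > 0 makes it C¹, and on the sphere it is 0.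
  set Δ : E → ℝ := fun x => inner ℝ x (w x) ^ 2 + ‖w x‖ ^ 2 * (1 - ‖x‖ ^ 2) with hΔ
  have hinner : ∀ x, ‖x‖ = 1 → 0 < inner ℝ x (w x) := by
    intro x hx
    have hle := real_inner_le_norm x (p x)
    have hpx := hmaps x hx.le
    rw [hx, one_mul] at hle
    simp only [hw]
    rw [inner_sub_right, real_inner_self_eq_norm_sq, hx]
    rcases lt_or_eq_of_le (hle.trans hpx) with h | h
    · linarith
    · exfalso
      have hpn : ‖p x‖ = 1 := le_antisymm hpx (h ▸ hle)
      exact hne x hx.le ((inner_eq_one_iff_of_norm_eq_one hx hpn).1 h).symm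
  have hΔ0 : ∀ x, ‖x‖ ≤ 1 → 0 < Δ x := by
    intro x hx
    rcases lt_or_eq_of_le hx with h | h
    · have : 0 < 1 - ‖x‖ ^ 2 := by nlinarith [norm_nonneg x]
      have := mul_pos (hw0 x hx) this
      simp only [hΔ]; positivity
    · have := hinner x h
      simp only [hΔ, h]
      norm_num
      positivity
  have hΔC : ContDiff ℝ 1 Δ :=
    ((contDiff_id.inner ℝ hwC).pow 2).add
      ((hwC.norm_sq ℝ).mul (contDiff_const.sub (contDiff_id.norm_sq ℝ)))
  set S : E → ℝ := fun x => (-inner ℝ x (w x) + Real.sqrt (Δ x)) / ‖w x‖ ^ 2 with hS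
  have hquad : ∀ i s W n : ℝ, W ≠ 0 → s ^ 2 = i ^ 2 + W * (1 - n) →
      n + 2 * ((-i + s) / W * i) + ((-i + s) / W) ^ 2 * W = 1 := by
    intro i s W n hW hs
    field_simp
    linarith
  refine no_contDiff_retraction (fun x => x + S x • w x) (fun x hx => ?_) (fun x hx => ?_)
    fun x hx => ?_
  · rw [mem_closedBall_zero_iff] at hx
    refine contDiffAt_id.add (ContDiffAt.smul (ContDiffAt.div ?_ (hwC.norm_sq ℝ).contDiffAt
      (hw0 x hx).ne') hwC.contDiffAt)
    exact (contDiff_id.inner ℝ hwC).neg.contDiffAt.add (hΔC.contDiffAt.sqrt (hΔ0 x hx).ne')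
  · rw [mem_closedBall_zero_iff] at hx
    have hsq := Real.sq_sqrt (hΔ0 x hx).le
    have hn0 := (hw0 x hx).ne'
    have : ‖x + S x • w x‖ ^ 2 = 1 := by
      rw [norm_add_sq_real, inner_smul_right, norm_smul, mul_pow, Real.norm_eq_abs, sq_abs]
      exact hquad _ _ _ _ hn0 hsq
    exact (pow_eq_one_iff_of_nonneg (norm_nonneg _) two_ne_zero).1 this
  · have : S x = 0 := by
      simp only [hS, hΔ, hx]
      norm_num
      left
      rw [Real.sqrt_sq (hinner x hx).le]; ring
    simp [this]

/-- **Brouwer's fixed point theorem**, for a continuous map of a Euclidean space into its closed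
unit ball. -/
theorem brouwer_closedBall [InnerProductSpace ℝ E] [FiniteDimensional ℝ E] (h : E → E)
    (hc : Continuous h) (hb : ∀ x, ‖h x‖ ≤ 1) : ∃ x, h x = x := by
  have happrox : ∀ ε : ℝ, 0 < ε → ∃ x, ‖x‖ ≤ 1 ∧ ‖h x - x‖ ≤ 2 * ε := by
    intro ε hε
    obtain ⟨g, hgC, hgd, -⟩ := hc.exists_contDiff_approx 1 continuous_const (fun _ => hε)
    have hg1 : ∀ x, ‖g x‖ ≤ 1 + ε := fun x => by
      have := norm_sub_norm_le (g x) (h x)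
      have h2 := hgd x
      rw [dist_eq_norm] at h2
      linarith [hb x]
    obtain ⟨x, hx, hpx⟩ := brouwer_contDiff (fun x => (1 + ε)⁻¹ • g x)
      (contDiff_const.smul (by exact_mod_cast hgC))
      fun x _ => by
        rw [norm_smul, Real.norm_of_nonneg (by positivity), inv_mul_le_iff₀ (by positivity)]
        simpa using hg1 x
    refine ⟨x, hx, ?_⟩
    have hgx : g x = x + ε • x := by
      rw [inv_smul_eq_iff₀ (by positivity)] at hpx
      rw [hpx, add_smul, one_smul]
    have h2 := hgd x
    rw [dist_eq_norm, norm_sub_rev] at h2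
    calc ‖h x - x‖ = ‖(h x - g x) + ε • x‖ := by rw [hgx]; congr 1; abel
      _ ≤ ‖h x - g x‖ + ε * ‖x‖ := by
        refine (norm_add_le _ _).trans ?_
        rw [norm_smul, Real.norm_of_nonneg hε.le]
      _ ≤ 2 * ε := by nlinarith
  obtain ⟨x, -, hmin⟩ := (isCompact_closedBall (0 : E) 1).exists_isMinOn ⟨0, by simp⟩
    (f := fun x => ‖h x - x‖) (by fun_prop)
  refine ⟨x, sub_eq_zero.1 (norm_eq_zero.1 (le_antisymm ?_ (norm_nonneg _)))⟩
  refine le_of_forall_pos_le_add fun ε hε => ?_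
  obtain ⟨y, hy, hy2⟩ := happrox (ε / 2) (half_pos hε)
  have := hmin (mem_closedBall_zero_iff.2 hy)
  simp only [mem_ofPred_eq] at this
  linarith

end Brouwer

/-! ### Kakutani–Fan fixed points -/

section Kakutani

open Set Filter Topology Metric

/-- **Brouwer's fixed point theorem** on the standard simplex. -/
theorem brouwer_stdSimplex {ι : Type*} [Fintype ι] [Nonempty ι] (φ : (ι → ℝ) → ι → ℝ)
    (hφ : ContinuousOn φ (stdSimplex ℝ ι)) (hmaps : MapsTo φ (stdSimplex ℝ ι) (stdSimplex ℝ ι)) :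
    ∃ x ∈ stdSimplex ℝ ι, φ x = x := by
  set σ : (ι → ℝ) → ℝ := fun x => ∑ i, max (x i) 0 with hσ
  -- A retraction onto the simplex: take positive parts, spread any deficit evenly, normalise any
  -- excess.
  set ρ : (ι → ℝ) → ι → ℝ := fun x i =>
    (max (x i) 0 + max (1 - σ x) 0 / Fintype.card ι) / max (σ x) 1 with hρ
  have hcard : (0 : ℝ) < Fintype.card ι := by exact_mod_cast Fintype.card_pos
  have hpos : ∀ x, 0 < max (σ x) 1 := fun x => lt_max_of_lt_right one_pos
  have hρmem : ∀ x, ρ x ∈ stdSimplex ℝ ι := by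
    refine fun x => ⟨fun i => ?_, ?_⟩
    · have := hpos x
      simp only [hρ]
      positivity
    · simp only [hρ]
      rw [← Finset.sum_div, Finset.sum_add_distrib, Finset.sum_const, Finset.card_univ,
        nsmul_eq_mul, mul_div_cancel₀ _ hcard.ne', div_eq_one_iff_eq (hpos x).ne']
      change σ x + _ = _
      rcases le_total (σ x) 1 with h | h
      · rw [max_eq_left (sub_nonneg.2 h), max_eq_right h]; ring
      · rw [max_eq_right (sub_nonpos.2 h), max_eq_left h, add_zero]
  have hρid : ∀ x ∈ stdSimplex ℝ ι, ρ x = x := by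
    intro x hx
    have h1 : σ x = 1 := by
      rw [← hx.2]
      exact Finset.sum_congr rfl fun i _ => max_eq_left (hx.1 i)
    funext i
    simp [hρ, h1, hx.1 i]
  have hρc : Continuous ρ := by
    refine continuous_pi fun i => Continuous.div ?_ ?_ fun x => (hpos x).ne'
    · simp only [hσ]; fun_prop
    · simp only [hσ]; fun_prop
  have hc : Continuous fun x => φ (ρ x) := hφ.comp_continuous hρc hρmem
  obtain ⟨x, hx⟩ := brouwer_closedBall (E := EuclideanSpace ℝ ι)
    (fun x => WithLp.toLp 2 (φ (ρ (WithLp.ofLp x))))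
    ((PiLp.continuous_toLp 2 _).comp (hc.comp (PiLp.continuous_ofLp 2 _))) fun x => by
      obtain ⟨h0, h1⟩ := hmaps (hρmem (WithLp.ofLp x))
      rw [EuclideanSpace.norm_eq, Real.sqrt_le_one]
      rw [← h1]
      refine Finset.sum_le_sum fun i _ => ?_
      have hi := h0 i
      have hi1 : φ (ρ (WithLp.ofLp x)) i ≤ 1 := by
        rw [← h1]
        exact Finset.single_le_sum (fun j _ => h0 j) (Finset.mem_univ i)
      simp only [Real.norm_eq_abs, sq_abs]
      nlinarith
  have hx' : φ (ρ (WithLp.ofLp x)) = WithLp.ofLp x := congrArg WithLp.ofLp hx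
  have hmem : WithLp.ofLp x ∈ stdSimplex ℝ ι := hx' ▸ hmaps (hρmem _)
  exact ⟨WithLp.ofLp x, hmem, by rwa [hρid _ hmem] at hx'⟩

variable {E : Type*} [NormedAddCommGroup E] [NormedSpace ℝ E]

/-- A set-valued self-map of a compact convex set with non-empty values has approximate fixed
points, up to convexification of nearby values. -/
theorem exists_mem_convexHull_nearby_values {Q : Set E} (hQ : IsCompact Q) (hQc : Convex ℝ Q)
    (hQne : Q.Nonempty) (Φ : Q → Set E) (hne : ∀ x, (Φ x).Nonempty) (hsub : ∀ x, Φ x ⊆ Q)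
    {ε : ℝ} (hε : 0 < ε) :
    ∃ x : Q, (x : E) ∈ convexHull ℝ (⋃ y ∈ {y : Q | dist x y < ε}, Φ y) := by
  have : CompactSpace Q := isCompact_iff_compactSpace.1 hQ
  have : Nonempty Q := hQne.to_subtype
  obtain ⟨t, ht⟩ := (isCompact_univ (X := Q)).elim_finite_subcover (fun y : Q => ball y ε)
    (fun _ => isOpen_ball) fun x _ => mem_iUnion.2 ⟨x, mem_ball_self hε⟩
  have hcov : ∀ x : Q, ∃ y ∈ t, dist x y < ε := fun x => by
    simpa using ht (mem_univ x)
  obtain ⟨y₀, hy₀, -⟩ := hcov (Classical.arbitrary Q)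
  have : Nonempty t := ⟨⟨y₀, hy₀⟩⟩
  choose ζ hζ using hne
  set m : t → E → ℝ := fun i x => max (ε - dist x (i : Q)) 0 with hm
  set M : E → ℝ := fun x => ∑ i, m i x with hM
  have hm0 : ∀ i x, 0 ≤ m i x := fun i x => le_max_right _ _
  have hMpos : ∀ x ∈ Q, 0 < M x := by
    intro x hx
    obtain ⟨y, hy, hxy⟩ := hcov ⟨x, hx⟩
    refine Finset.sum_pos' (fun i _ => hm0 i x) ⟨⟨y, hy⟩, Finset.mem_univ _, ?_⟩
    exact lt_max_of_lt_left (sub_pos.2 hxy)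
  set Z : (t → ℝ) → E := fun l => ∑ i, l i • ζ i with hZ
  have hZQ : ∀ l ∈ stdSimplex ℝ t, Z l ∈ Q := fun l hl =>
    hQc.sum_mem (fun i _ => hl.1 i) hl.2 fun i _ => hsub _ (hζ _)
  have hZc : Continuous Z := by fun_prop
  have hmc : ∀ i, Continuous (m i) := fun i => by simp only [hm]; fun_prop
  -- At a fixed point, l is the partition of unity evaluated at Z l, so only net points ε-close to Z
  -- l carry weight.
  obtain ⟨l, hl, hfix⟩ := brouwer_stdSimplex (fun l i => m i (Z l) / M (Z l))
    (continuousOn_pi.2 fun i => ContinuousOn.div ((hmc i).comp hZc).continuousOn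
      ((continuous_finsetSum _ fun i _ => (hmc i).comp hZc).continuousOn)
      fun l hl => (hMpos _ (hZQ l hl)).ne')
    fun l hl => ⟨fun i => div_nonneg (hm0 _ _) (hMpos _ (hZQ l hl)).le, by
      rw [← Finset.sum_div]
      exact div_self (hMpos _ (hZQ l hl)).ne'⟩
  refine ⟨⟨Z l, hZQ l hl⟩, ?_⟩
  have hsupp : ∀ i : t, l i ≠ 0 → dist (Z l) (i : Q) < ε := by
    intro i hi
    by_contra! h
    refine hi ?_
    have := congrFun hfix i
    simp only [hm] at this
    rw [max_eq_right (by linarith), zero_div] at this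
    exact this.symm
  have hsum := Finset.sum_filter_ne_zero (s := (Finset.univ : Finset t)) (f := l)
  have hZfilter : Z l = ∑ i with l i ≠ 0, l i • ζ i := by
    refine (Finset.sum_filter_of_ne fun i _ hi => ?_).symm
    exact fun h => hi (by rw [h, zero_smul])
  refine mem_of_eq_of_mem hZfilter ?_
  refine (convex_convexHull ℝ _).sum_mem (fun i _ => hl.1 i) (hsum.trans hl.2) fun i hi => ?_
  refine subset_convexHull ℝ _ (mem_iUnion₂.2 ⟨i, ?_, hζ i⟩)
  exact hsupp i (Finset.mem_filter.1 hi).2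

/-- **Kakutani–Fan fixed point theorem** in a normed space: a set-valued self-map of a non-empty
compact convex set with non-empty convex values and closed graph has a fixed point. -/
theorem kakutani_fan {Q : Set E} (hQ : IsCompact Q) (hQc : Convex ℝ Q) (hQne : Q.Nonempty)
    (Φ : Q → Set E) (hne : ∀ x, (Φ x).Nonempty) (hconv : ∀ x, Convex ℝ (Φ x))
    (hsub : ∀ x, Φ x ⊆ Q) (hgraph : IsClosed {p : Q × E | p.2 ∈ Φ p.1}) :
    ∃ x : Q, (x : E) ∈ Φ x := by
  have : CompactSpace Q := isCompact_iff_compactSpace.1 hQ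
  have happ : ∀ n : ℕ, ∃ x : Q,
      (x : E) ∈ convexHull ℝ (⋃ y ∈ {y : Q | dist x y < 1 / ((n : ℝ) + 1)}, Φ y) := fun n =>
    exists_mem_convexHull_nearby_values hQ hQc hQne Φ hne hsub Nat.one_div_pos_of_nat
  choose u hu using happ
  obtain ⟨x, θ, hθ, hx⟩ := CompactSpace.tendsto_subseq u
  refine ⟨x, ?_⟩
  have husc : UpperHemicontinuousAt Φ x :=
    .of_sequences hQ.isSeqCompact (.of_forall hsub) fun a ha b hb b₀ hb₀ =>
      hgraph.mem_of_tendsto (ha.prodMk_nhds hb₀) (.of_forall hb)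
  have hcl : IsClosed (Φ x) := hgraph.preimage (Continuous.prodMk_right x)
  rw [← hcl.closure_eq, closure_eq_iInter_cthickening]
  refine mem_iInter₂.2 fun η hη => ?_
  have hev := husc (thickening η (Φ x)) (isOpen_thickening.mem_nhdsSet.2 (self_subset_thickening hη _))
  obtain ⟨δ, hδ, hball⟩ := Metric.eventually_nhds_iff.1 hev
  refine isClosed_cthickening.mem_of_tendsto
    ((continuous_subtype_val.tendsto x).comp hx) ?_
  have h1 : ∀ᶠ n in atTop, dist (u (θ n)) x < δ / 2 :=
    hx.eventually (ball_mem_nhds x (half_pos hδ))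
  have h2 : ∀ᶠ n in atTop, 1 / (((θ n : ℕ) : ℝ) + 1) < δ / 2 :=
    (tendsto_one_div_add_atTop_nhds_zero_nat.comp hθ.tendsto_atTop).eventually_lt_const
      (half_pos hδ)
  filter_upwards [h1, h2] with n hn1 hn2
  refine thickening_subset_cthickening _ _ ?_
  refine convexHull_min (iUnion₂_subset fun y hy => ?_) ((hconv x).thickening η) (hu (θ n))
  have hy' : dist (u (θ n)) y < 1 / (((θ n : ℕ) : ℝ) + 1) := hy
  have := hball (show dist y x < δ by
    have := dist_triangle_left y x (u (θ n))
    linarith)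
  exact subset_of_mem_nhdsSet this

end Kakutani

/-! ### Stampacchia inequalities and Minty's lemma -/

section VariationalInequality

open Set Filter Topology Metric

/-- The graph of the argmin map of a continuous function over a lower hemicontinuous
correspondence with closed graph is closed. -/
theorem isClosed_graph_argmin {P Y : Type*} [TopologicalSpace P] [TopologicalSpace Y]
    {T : P → Set Y} (hlsc : LowerHemicontinuous T) (hgraph : IsClosed {p : P × Y | p.2 ∈ T p.1})
    {φ : P → Y → ℝ} (hφ : Continuous fun p : P × Y => φ p.1 p.2) :
    IsClosed {p : P × Y | p.2 ∈ T p.1 ∧ ∀ z ∈ T p.1, φ p.1 p.2 ≤ φ p.1 z} := by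
  refine hgraph.inter (s₂ := {p : P × Y | ∀ z ∈ T p.1, φ p.1 p.2 ≤ φ p.1 z}) ?_
  rw [← isOpen_compl_iff, isOpen_iff_mem_nhds]
  intro p hp
  simp only [mem_compl_iff, mem_ofPred_eq, not_forall, not_le] at hp
  obtain ⟨z, hz, hlt⟩ := hp
  have hopen : IsOpen {q : (P × Y) × Y | φ q.1.1 q.2 < φ q.1.1 q.1.2} :=
    isOpen_lt (hφ.comp (continuous_fst.fst.prodMk continuous_snd)) (hφ.comp continuous_fst)
  obtain ⟨U, V, hU, hV, hpU, hzV, hUV⟩ := isOpen_prod_iff.1 hopen p z hlt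
  have hev := lowerHemicontinuousAt_iff.1 (hlsc.lowerHemicontinuousAt p.1) V hV ⟨z, hz, hzV⟩
  filter_upwards [hU.mem_nhds hpU, continuous_fst.continuousAt.eventually hev] with q hqU hq h
  obtain ⟨z', hz', hz'V⟩ := hq
  have hlt' : φ q.1 z' < φ q.1 q.2 := hUV (show (q, z') ∈ U ×ˢ V from ⟨hqU, hz'V⟩)
  exact absurd (h z' hz') (not_le.2 hlt')

/-- Mazur's theorem: convex hulls preserve total boundedness, and completeness gives compactness of
the closure. -/
theorem isCompact_closedConvexHull_of_totallyBounded {E : Type*} [NormedAddCommGroup E]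
    [NormedSpace ℝ E] [CompleteSpace E] {s : Set E} (hs : TotallyBounded s) :
    IsCompact (closedConvexHull ℝ s) := by
  rw [closedConvexHull_eq_closure_convexHull]
  exact (totallyBounded_convexHull.2 hs).closure.isCompact_of_isClosed isClosed_closure

/-- The image of a compact set under an upper hemicontinuous correspondence with compact values is
totally bounded. -/
theorem totallyBounded_biUnion_of_upperHemicontinuousOn {α β : Type*} [TopologicalSpace α]
    [PseudoMetricSpace β] {F : α → Set β} {s : Set α} (hs : IsCompact s)
    (hF : UpperHemicontinuousOn F s) (hcomp : ∀ x ∈ s, IsCompact (F x)) :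
    TotallyBounded (⋃ x ∈ s, F x) := by
  rw [Metric.totallyBounded_iff]
  intro ε hε
  refine hs.induction_on (p := fun t => ∃ c : Set β, c.Finite ∧ ⋃ x ∈ t, F x ⊆ ⋃ y ∈ c, ball y ε)
    ⟨∅, finite_empty, by simp⟩ ?_ ?_ ?_
  · rintro a b hab ⟨c, hc, hbc⟩
    exact ⟨c, hc, (biUnion_subset_biUnion_left hab).trans hbc⟩
  · rintro a b ⟨c, hc, hac⟩ ⟨d, hd, hbd⟩
    refine ⟨c ∪ d, hc.union hd, ?_⟩
    rw [biUnion_union, biUnion_union]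
    exact union_subset_union hac hbd
  · intro x hx
    obtain ⟨c, hc, hxc⟩ := Metric.totallyBounded_iff.1 (hcomp x hx).totallyBounded ε hε
    have hev := hF.forall_isOpen x hx _ (isOpen_biUnion fun y _ => isOpen_ball) hxc
    exact ⟨_, hev, c, hc, iUnion₂_subset fun y hy => hy⟩

variable {X : Type*} [NormedAddCommGroup X] [NormedSpace ℝ X]

theorem convex_argmin {C : Set X} (hC : Convex ℝ C) (l : StrongDual ℝ X) :
    Convex ℝ {y | y ∈ C ∧ ∀ z ∈ C, l y ≤ l z} := by
  intro y hy z hz a b ha hb hab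
  refine ⟨hC hy.1 hz.1 ha hb hab, fun w hw => ?_⟩
  rw [map_add, map_smul, map_smul, smul_eq_mul, smul_eq_mul]
  calc a * l y + b * l z ≤ a * l w + b * l w := by
        gcongr
        exacts [hy.2 w hw, hz.2 w hw]
    _ = l w := by rw [← add_mul, hab, one_mul]

/-- A Stampacchia variational inequality over a compact convex set, for an upper hemicontinuous
operator with non-empty convex compact values, has a solution. -/
theorem exists_stampacchia_solution {F : X → Set (StrongDual ℝ X)} {C : Set X}
    (hC : IsCompact C) (hCconv : Convex ℝ C) (hCne : C.Nonempty)
    (hne : ∀ x ∈ C, (F x).Nonempty) (hconv : ∀ x ∈ C, Convex ℝ (F x))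
    (hcomp : ∀ x ∈ C, IsCompact (F x)) (husc : UpperHemicontinuousOn F C) :
    ∃ x ∈ C, ∃ x' ∈ F x, ∀ z ∈ C, 0 ≤ x' (z - x) := by
  set W := closedConvexHull ℝ (⋃ x ∈ C, F x) with hW
  have hWcomp : IsCompact W := isCompact_closedConvexHull_of_totallyBounded
    (totallyBounded_biUnion_of_upperHemicontinuousOn hC husc hcomp)
  have hFW : ∀ x ∈ C, F x ⊆ W := fun x hx =>
    (subset_biUnion_of_mem (u := F) hx).trans subset_closedConvexHull
  have hWne : W.Nonempty := hCne.elim fun x hx => (hne x hx).mono (hFW x hx)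
  have hQ : ∀ q : ↥(C ×ˢ W), q.1.1 ∈ C := fun q => q.2.1
  -- Fixed points (x, x') are sought: x minimises x' over C, and x' ∈ F x.
  obtain ⟨q, hq⟩ := kakutani_fan (hC.prod hWcomp) (hCconv.prod convex_closedConvexHull)
    (hCne.prod hWne)
    (fun q => {y | y ∈ C ∧ ∀ z ∈ C, q.1.2 y ≤ q.1.2 z} ×ˢ F q.1.1)
    (fun q => by
      obtain ⟨y, hy, hmin⟩ := hC.exists_isMinOn hCne q.1.2.continuous.continuousOn
      exact Set.Nonempty.prod ⟨y, hy, fun z hz => hmin hz⟩ (hne _ (hQ q)))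
    (fun q => by
      exact (convex_argmin hCconv _).prod (hconv _ (hQ q)))
    (fun q => prod_mono (fun y hy => hy.1) (hFW _ (hQ q)))
    (by
      have h1 := isClosed_graph_argmin (P := ↥(C ×ˢ W)) (T := fun _ => C)
        LowerHemicontinuous.const (hC.isClosed.preimage continuous_snd)
        (φ := fun q y => q.1.2 y) (by fun_prop)
      have h2 : IsClosed {p : ↥(C ×ˢ W) × StrongDual ℝ X | p.2 ∈ F p.1.1.1} := by
        refine IsSeqClosed.isClosed fun p p₀ hp hlim => ?_
        have hus : UpperHemicontinuousAt (fun q : C => F q) ⟨p₀.1.1.1, hQ _⟩ :=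
          (upperHemicontinuousOn_iff_restrict.2 husc).upperHemicontinuousAt _
        refine hus.mem_of_tendsto (hcomp _ (hQ p₀.1)).isClosed (l := atTop)
          (x := fun n => ⟨(p n).1.1.1, hQ _⟩) (y := fun n => (p n).2) ?_
          (Frequently.of_forall hp) ((continuous_snd.tendsto _).comp hlim)
        rw [tendsto_subtype_rng]
        exact (continuous_fst.subtype_val.fst.tendsto p₀).comp hlim
      exact (h1.preimage (continuous_fst.prodMk continuous_snd.fst)).inter
        (h2.preimage (continuous_fst.prodMk continuous_snd.snd)))
  refine ⟨q.1.1, hQ q, q.1.2, hq.2, fun z hz => ?_⟩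
  rw [map_sub]
  exact sub_nonneg.2 (hq.1.2 z hz)

/-- The solutions `x ∈ C` of the weak Stampacchia variational inequality, in which the functional
`x' ∈ F x` may depend on the test point. -/
def weakStampacchia (F : X → Set (StrongDual ℝ X)) (C : Set X) : Set X :=
  {x | x ∈ C ∧ ∀ y ∈ C, ∃ x' ∈ F x, 0 ≤ x' (y - x)}

/-- **Minty's lemma** for pseudomonotone operators. -/
theorem mem_weakStampacchia_iff_minty {F : X → Set (StrongDual ℝ X)} {C : Set X}
    (hCconv : Convex ℝ C) (hne : ∀ x ∈ C, (F x).Nonempty) (husc : UpperHemicontinuousOn F C)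
    (hpm : IsPseudomonotoneOn F C) {x : X} :
    x ∈ weakStampacchia F C ↔ x ∈ C ∧ ∀ y ∈ C, ∀ y' ∈ F y, 0 ≤ y' (y - x) := by
  refine ⟨fun h => ⟨h.1, fun y hy => hpm x h.1 y hy (h.2 y hy)⟩, fun h => ⟨h.1, fun y hy => ?_⟩⟩
  -- If every functional in F x is negative on y - x, upper hemicontinuity keeps this so slightly
  -- along the segment towards y, against the Minty inequality there.
  by_contra! hneg
  have hev := husc.forall_isOpen x h.1 {x' | x' (y - x) < 0}
    (isOpen_lt (by fun_prop) continuous_const) hneg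
  have hline : Tendsto (fun t : ℝ => x + t • (y - x)) (𝓝[>] 0) (𝓝[C] x) := by
    refine tendsto_nhdsWithin_iff.2 ⟨?_, ?_⟩
    · have : Continuous fun t : ℝ => x + t • (y - x) := by fun_prop
      simpa using (this.tendsto 0).mono_left nhdsWithin_le_nhds
    · filter_upwards [Ioc_mem_nhdsGT one_pos] with t ht
      exact hCconv.add_smul_sub_mem h.1 hy ⟨ht.1.le, ht.2⟩
  obtain ⟨t, ⟨hsub, htC⟩, ht⟩ := (((hline.eventually hev).and
    (hline.eventually self_mem_nhdsWithin)).and self_mem_nhdsWithin).exists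
  obtain ⟨y', hy'⟩ := hne _ htC
  have h1 := h.2 _ htC y' hy'
  rw [add_sub_cancel_left, map_smul, smul_eq_mul] at h1
  have h2 : y' (y - x) < 0 := hsub hy'
  have h3 : (0 : ℝ) < t := ht
  nlinarith

/-- In Minty form the conditions are affine inequalities in the solution, with functionals
independent of it. -/
theorem convex_weakStampacchia {F : X → Set (StrongDual ℝ X)} {C : Set X}
    (hCconv : Convex ℝ C) (hne : ∀ x ∈ C, (F x).Nonempty) (husc : UpperHemicontinuousOn F C)
    (hpm : IsPseudomonotoneOn F C) : Convex ℝ (weakStampacchia F C) := by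
  intro x hx y hy a b ha hb hab
  rw [mem_weakStampacchia_iff_minty hCconv hne husc hpm] at hx hy ⊢
  refine ⟨hCconv hx.1 hy.1 ha hb hab, fun z hz z' hz' => ?_⟩
  have : z - (a • x + b • y) = a • (z - x) + b • (z - y) := by
    rw [smul_sub, smul_sub, sub_add_sub_comm, ← add_smul, hab, one_smul]
  rw [this, map_add, map_smul, map_smul, smul_eq_mul, smul_eq_mul]
  exact add_nonneg (mul_nonneg ha (hx.2 z hz z' hz')) (mul_nonneg hb (hy.2 z hz z' hz'))

/-- By the minimax theorem, a weak solution of the Stampacchia variational inequality is a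
solution with one functional for all test points. -/
theorem exists_functional_of_mem_weakStampacchia {F : X → Set (StrongDual ℝ X)} {C : Set X}
    (hC : IsCompact C) (hCconv : Convex ℝ C) {x : X} (hx : x ∈ weakStampacchia F C)
    (hne : (F x).Nonempty) (hconv : Convex ℝ (F x)) (hcomp : IsCompact (F x)) :
    ∃ x' ∈ F x, ∀ z ∈ C, 0 ≤ x' (z - x) := by
  obtain ⟨a, ha, b, hb, hab⟩ := Sion.exists_isSaddlePointOn (X := C) (Y := F x)
    (f := fun z x' => x' (z - x)) ⟨x, hx.1⟩ hCconv hC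
    (fun y _ => Continuous.lowerSemicontinuous (by fun_prop) |>.lowerSemicontinuousOn _)
    (fun y _ => by
      refine ConvexOn.quasiconvexOn ⟨hCconv, fun u _ v _ s t _ _ hst => le_of_eq ?_⟩
      simp only [map_sub, map_add, map_smul, smul_eq_mul]
      linear_combination y x * hst)
    hconv hne hcomp
    (fun z _ => Continuous.upperSemicontinuous (by fun_prop) |>.upperSemicontinuousOn _)
    (fun z _ => ConcaveOn.quasiconcaveOn ⟨hconv, fun u _ v _ s t _ _ _ => le_of_eq (by simp)⟩)
  -- Testing the weak inequality at a shows that the saddle value is non-negative.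
  obtain ⟨x', hx', h0⟩ := hx.2 a ha
  exact ⟨b, hb, fun z hz => h0.trans (hab z hz x' hx')⟩

/-- The weak solution set of the Stampacchia variational inequality depends on the constraint set
with closed graph. -/
theorem isClosed_graph_weakStampacchia {P : Type*} [TopologicalSpace P] {T : P → Set X}
    (hlsc : LowerHemicontinuous T) (hgraph : IsClosed {p : P × X | p.2 ∈ T p.1}) {s : Set X}
    (hTs : ∀ p, T p ⊆ s) {F : X → Set (StrongDual ℝ X)} (hcomp : ∀ x ∈ s, IsCompact (F x))
    (husc : UpperHemicontinuousOn F s) :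
    IsClosed {p : P × X | p.2 ∈ weakStampacchia F (T p.1)} := by
  refine isClosed_of_closure_subset fun p hp => ?_
  have hpT : p.2 ∈ T p.1 := closure_minimal (fun q hq => hq.1) hgraph hp
  refine ⟨hpT, fun y hy => ?_⟩
  by_contra! hneg
  have hopen : IsOpen {q : StrongDual ℝ X × X | q.1 q.2 < 0} :=
    isOpen_lt (by fun_prop) continuous_const
  -- Strict negativity on the compact set F x × {y - x} persists nearby; lower hemicontinuity
  -- supplies a nearby test point y', contradicting the weak inequality.
  obtain ⟨U, V, hU, hV, hFU, hyV, hUV⟩ := generalized_tube_lemma (hcomp _ (hTs _ hpT))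
    (isCompact_singleton (x := y - p.2)) hopen (by
      rintro ⟨x', w⟩ ⟨hx', hw⟩
      rw [mem_singleton_iff] at hw
      subst hw
      exact hneg x' hx')
  have hFev := eventually_nhdsWithin_iff.1 (husc.forall_isOpen p.2 (hTs _ hpT) U hU hFU)
  have hsub : IsOpen {q : X × X | q.2 - q.1 ∈ V} :=
    hV.preimage (continuous_snd.sub continuous_fst)
  obtain ⟨A, B, hA, hB, hpA, hyB, hAB⟩ :=
    isOpen_prod_iff.1 hsub p.2 y (hyV (mem_singleton _))
  have hlev := lowerHemicontinuousAt_iff.1 (hlsc.lowerHemicontinuousAt p.1) B hB ⟨y, hy, hyB⟩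
  obtain ⟨q, hq, hqF, hqA, y', hy', hy'B⟩ := ((mem_closure_iff_frequently.1 hp).and_eventually
    ((continuous_snd.continuousAt.eventually hFev).and
      ((continuous_snd.continuousAt.eventually (hA.mem_nhds hpA)).and
        (continuous_fst.continuousAt.eventually hlev)))).exists
  obtain ⟨x', hx', h0⟩ := hq.2 y' hy'
  have hmem : (x', y' - q.2) ∈ U ×ˢ V := ⟨hqF (hTs _ hq.1) hx',
    hAB (show (q.2, y') ∈ A ×ˢ B from ⟨hqA, hy'B⟩)⟩
  exact absurd h0 (not_le.2 (hUV hmem))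

end VariationalInequality

/-! ### Truncation and the quasi-variational inequality -/

section QuasiVariationalInequality

open Set Filter Topology Metric

variable {X : Type*} [NormedAddCommGroup X] [NormedSpace ℝ X]

/-- Truncating a lower hemicontinuous correspondence with convex values by a closed ball preserves
lower hemicontinuity if all values meet the open ball. -/
theorem LowerHemicontinuous.inter_closedBall {P : Type*} [TopologicalSpace P] {T : P → Set X}
    (hT : LowerHemicontinuous T) (hconv : ∀ p, Convex ℝ (T p)) {r : ℝ}
    (hne : ∀ p, (T p ∩ ball 0 r).Nonempty) :
    LowerHemicontinuous fun p => T p ∩ closedBall 0 r := by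
  refine lowerHemicontinuous_iff.2 fun p => lowerHemicontinuousAt_iff.2 ?_
  rintro U hU ⟨x, ⟨hxT, hxr⟩, hxU⟩
  obtain ⟨y, hyT, hyr⟩ := hne p
  -- A small move towards y enters the open ball, so lower hemicontinuity can be applied to an open
  -- set.
  have hline : Tendsto (fun t : ℝ => x + t • (y - x)) (𝓝[>] 0) (𝓝 x) := by
    have : Continuous fun t : ℝ => x + t • (y - x) := by fun_prop
    simpa using (this.tendsto 0).mono_left nhdsWithin_le_nhds
  obtain ⟨t, htU, ht0, ht1⟩ :=
    ((hline.eventually (hU.mem_nhds hxU)).and (Ioc_mem_nhdsGT one_pos)).exists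
  have htT : x + t • (y - x) ∈ T p := (hconv p).add_smul_sub_mem hxT hyT ⟨ht0.le, ht1⟩
  have htr : x + t • (y - x) ∈ ball (0 : X) r := by
    rw [mem_ball_zero_iff] at hyr ⊢
    rw [mem_closedBall_zero_iff] at hxr
    have heq : x + t • (y - x) = (1 - t) • x + t • y := by module
    calc ‖x + t • (y - x)‖ ≤ (1 - t) * ‖x‖ + t * ‖y‖ := by
          rw [heq]
          refine (norm_add_le _ _).trans_eq ?_
          rw [norm_smul, norm_smul, Real.norm_of_nonneg (sub_nonneg.2 ht1),
            Real.norm_of_nonneg ht0.le]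
      _ < r := by nlinarith
  have hev := lowerHemicontinuousAt_iff.1 (hT.lowerHemicontinuousAt p) (U ∩ ball 0 r)
    (hU.inter isOpen_ball) ⟨_, htT, htU, htr⟩
  filter_upwards [hev] with q hq
  obtain ⟨z, hzT, hzU, hzr⟩ := hq
  exact ⟨z, ⟨hzT, ball_subset_closedBall hzr⟩, hzU⟩

/-- Under the coercivity condition, the values of the constraint map meet the open ball of radius
`r` as soon as their truncations by the closed ball are compact and non-empty. -/
theorem IsCoercivityRadius.nonempty_inter_ball {D : Set X} {F : X → Set (StrongDual ℝ X)}
    {K : D → Set X} {d : D} {ρ r : ℝ} (hρ : IsCoercivityRadius F K d ρ) (hρr : ρ < r)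
    (hcomp : IsCompact (K d ∩ closedBall 0 r)) (hne : (K d ∩ closedBall 0 r).Nonempty) :
    (K d ∩ ball 0 r).Nonempty := by
  -- A point of least norm cannot lie on the sphere, since coercivity would give a shorter one.
  obtain ⟨x, hx, hmin⟩ := hcomp.exists_isMinOn hne continuous_norm.continuousOn
  refine ⟨x, hx.1, ?_⟩
  by_contra hxr
  have hxr' : r ≤ ‖x‖ := by simpa using hxr
  obtain ⟨y, hy, hyx, -⟩ := hρ.2 x ⟨hx.1, by simpa using hρr.trans_le hxr'⟩
  have hxr2 : ‖x‖ ≤ r := by simpa using hx.2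
  have : ‖x‖ ≤ ‖y‖ := hmin ⟨hy, by simpa using hyx.le.trans hxr2⟩
  exact absurd hyx (not_lt.2 this)

/-- Under the coercivity condition, a solution of the truncated variational inequality solves the
untruncated one. -/
theorem IsCoercivityRadius.solution_of_truncated {D : Set X} {F : X → Set (StrongDual ℝ X)}
    {K : D → Set X} {d : D} {ρ r : ℝ} (hρ : IsCoercivityRadius F K d ρ) (hρr : ρ < r)
    (hconv : Convex ℝ (K d)) {x : X} (hx : x ∈ K d ∩ closedBall 0 r) {x' : StrongDual ℝ X}
    (hx' : x' ∈ F x) (hsol : ∀ z ∈ K d ∩ closedBall 0 r, 0 ≤ x' (z - x)) :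
    ∀ z ∈ K d, 0 ≤ x' (z - x) := by
  have hxr : ‖x‖ ≤ r := by simpa using hx.2
  -- From y, strictly inside the ball, a short step towards any z ∈ K d is still admissible; x' (y -
  -- x) ≤ 0 then transfers the inequality to z.
  obtain ⟨y, hyK, hyr, hyx⟩ : ∃ y ∈ K d, ‖y‖ < r ∧ x' (y - x) ≤ 0 := by
    rcases hxr.lt_or_eq with h | h
    · exact ⟨x, hx.1, h, by simp⟩
    · obtain ⟨y, hy, hyx, h0⟩ := hρ.2 x ⟨hx.1, by simpa [h] using hρr⟩
      refine ⟨y, hy, hyx.trans_eq h, ?_⟩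
      have := h0 x' hx'
      rw [← neg_sub, map_neg]
      linarith
  intro z hz
  have hline : Tendsto (fun t : ℝ => y + t • (z - y)) (𝓝[>] 0) (𝓝 y) := by
    have : Continuous fun t : ℝ => y + t • (z - y) := by fun_prop
    simpa using (this.tendsto 0).mono_left nhdsWithin_le_nhds
  obtain ⟨t, htr, ht0, ht1⟩ := ((hline.eventually (isOpen_ball.mem_nhds
    (mem_ball_zero_iff.2 hyr))).and (Ioc_mem_nhdsGT one_pos)).exists
  have h := hsol _ ⟨hconv.add_smul_sub_mem hyK hz ⟨ht0.le, ht1⟩, ball_subset_closedBall htr⟩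
  have heq : y + t • (z - y) - x = (1 - t) • (y - x) + t • (z - x) := by module
  rw [heq, map_add, map_smul, map_smul, smul_eq_mul, smul_eq_mul] at h
  have h1 : (1 - t) * x' (y - x) ≤ 0 := mul_nonpos_of_nonneg_of_nonpos (sub_nonneg.2 ht1) hyx
  exact nonneg_of_mul_nonneg_right (by linarith) ht0

/-- A quasi-variational inequality whose constraint map takes values in a compact set has a
solution. -/
theorem exists_isQVISolution_of_isCompact [CompleteSpace X] {D : Set X} (hDne : D.Nonempty)
    (hDconv : Convex ℝ D) (hDcomp : IsCompact D) {f : X → StrongDual ℝ X} (hf : Continuous f)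
    {K : D → Set X} (hKne : ∀ d, (K d).Nonempty) (hKconv : ∀ d, Convex ℝ (K d))
    (hKlsc : LowerHemicontinuous K) (hKgraph : IsClosed {p : D × X | p.2 ∈ K p.1})
    {C : Set X} (hC : IsCompact C) (hKC : ∀ d, K d ⊆ C) {F : X → Set (StrongDual ℝ X)}
    {s : Set X} (hKs : ∀ d, K d ⊆ s) (hFne : ∀ x ∈ s, (F x).Nonempty)
    (hFconv : ∀ x ∈ s, Convex ℝ (F x)) (hFcomp : ∀ x ∈ s, IsCompact (F x))
    (hFusc : UpperHemicontinuousOn F s) (hFpm : IsPseudomonotoneOn F s) :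
    ∃ (d₀ : D) (x₀ : X), IsQVISolution F f K d₀ x₀ := by
  set W := closedConvexHull ℝ C with hW
  have hWcomp : IsCompact W := isCompact_closedConvexHull_of_totallyBounded hC.totallyBounded
  have hCW : C ⊆ W := subset_closedConvexHull
  have hWne : W.Nonempty := (hKne ⟨_, hDne.some_mem⟩).mono ((hKC _).trans hCW)
  have hKcl : ∀ d, IsClosed (K d) := fun d => hKgraph.preimage (Continuous.prodMk_right d)
  have hKcomp : ∀ d, IsCompact (K d) := fun d => hC.of_isClosed_subset (hKcl d) (hKC d)
  let π : ↥(D ×ˢ W) → D := fun q => ⟨q.1.1, q.2.1⟩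
  have hπ : Continuous π := continuous_subtype_val.fst.subtype_mk _
  obtain ⟨q, hq⟩ := kakutani_fan (hDcomp.prod hWcomp) (hDconv.prod convex_closedConvexHull)
    (hDne.prod hWne)
    (fun q => {e | e ∈ D ∧ ∀ e' ∈ D, f q.1.2 e ≤ f q.1.2 e'} ×ˢ weakStampacchia F (K (π q)))
    (fun q => by
      obtain ⟨e, he, hmin⟩ := hDcomp.exists_isMinOn hDne (f q.1.2).continuous.continuousOn
      obtain ⟨x, hx, x', hx', h⟩ := exists_stampacchia_solution (hKcomp (π q)) (hKconv _) (hKne _)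
        (fun x hx => hFne x (hKs _ hx)) (fun x hx => hFconv x (hKs _ hx))
        (fun x hx => hFcomp x (hKs _ hx)) (hFusc.mono (hKs _))
      exact Set.Nonempty.prod ⟨e, he, fun z hz => hmin hz⟩
        ⟨x, hx, fun y hy => ⟨x', hx', h y hy⟩⟩)
    (fun q => by
      refine (convex_argmin hDconv _).prod (convex_weakStampacchia (hKconv _) (fun x hx => hFne x (hKs _ hx))
        (hFusc.mono (hKs _)) fun x hx y hy => hFpm x (hKs _ hx) y (hKs _ hy)))
    (fun q => prod_mono (fun y hy => hy.1) fun x hx => hCW (hKC _ hx.1))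
    (by
      have h1 := isClosed_graph_argmin (P := ↥(D ×ˢ W)) (T := fun _ => D)
        LowerHemicontinuous.const (hDcomp.isClosed.preimage continuous_snd)
        (φ := fun q y => f q.1.2 y) (by fun_prop)
      have h2 := isClosed_graph_weakStampacchia hKlsc hKgraph hKs hFcomp hFusc
      exact (h1.preimage (continuous_fst.prodMk continuous_snd.fst)).inter
        (h2.preimage ((hπ.comp continuous_fst).prodMk continuous_snd.snd)))
  have hx : q.1.2 ∈ weakStampacchia F (K (π q)) := hq.2
  have hxs := hKs _ hx.1
  obtain ⟨x', hx', h⟩ := exists_functional_of_mem_weakStampacchia (hKcomp _) (hKconv _) hx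
    (hFne _ hxs) (hFconv _ hxs) (hFcomp _ hxs)
  refine ⟨π q, q.1.2, hx.1, x', hx', fun d z hz => add_nonneg ?_ (h z hz)⟩
  rw [map_sub]
  exact sub_nonneg.2 (hq.1.2 d d.2)

end QuasiVariationalInequality

theorem mainTheorem3 {X : Type*} [NormedAddCommGroup X] [NormedSpace ℝ X] [CompleteSpace X]
    (D : Set X) (hDne : D.Nonempty) (hDconv : Convex ℝ D) (hDcomp : IsCompact D)
    (f : X →ᴬ[ℝ] StrongDual ℝ X)
    (K : D → Set X)
    (hKne : ∀ d, (K d).Nonempty) (hKconv : ∀ d, Convex ℝ (K d))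
    (hKlsc : LowerHemicontinuous K)
    (hKgraph : IsClosed {p : D × X | p.2 ∈ K p.1})
    (F : X → Set (StrongDual ℝ X))
    (hFne : ∀ x ∈ convexHull ℝ (⋃ d, K d), (F x).Nonempty)
    (hFconv : ∀ x ∈ convexHull ℝ (⋃ d, K d), Convex ℝ (F x))
    (hFcomp : ∀ x ∈ convexHull ℝ (⋃ d, K d), IsCompact (F x))
    (hFusc : UpperHemicontinuousOn F (convexHull ℝ (⋃ d, K d)))
    (hFpm : IsPseudomonotoneOn F (convexHull ℝ (⋃ d, K d)))
    (rd : D → ℝ) (hrd : ∀ d, IsCoercivityRadius F K d (rd d))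
    (r : ℝ) (hrdbdd : BddAbove (Set.range rd)) (hr : (⨆ d, rd d) < r)
    (hKDcomp : IsCompact ((⋃ d, K d) ∩ Metric.closedBall (0 : X) r))
    (hKrne : ∀ d, (K d ∩ Metric.closedBall (0 : X) r).Nonempty) :
    ∃ (d₀ : D) (x₀ : X), IsQVISolution F f K d₀ x₀ := by
  have hlt : ∀ d, rd d < r := fun d => (le_ciSup hrdbdd d).trans_lt hr
  set C := (⋃ d, K d) ∩ Metric.closedBall (0 : X) r with hCdef
  have hKC : ∀ d, K d ∩ Metric.closedBall 0 r ⊆ C := fun d =>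
    Set.inter_subset_inter_left _ (Set.subset_iUnion K d)
  have hgraph : IsClosed {p : D × X | p.2 ∈ K p.1 ∩ Metric.closedBall (0 : X) r} :=
    hKgraph.inter (Metric.isClosed_closedBall.preimage continuous_snd)
  have hcomp : ∀ d, IsCompact (K d ∩ Metric.closedBall (0 : X) r) := fun d =>
    hKDcomp.of_isClosed_subset (hgraph.preimage (Continuous.prodMk_right d)) (hKC d)
  have hlsc := hKlsc.inter_closedBall hKconv fun d =>
    (hrd d).nonempty_inter_ball (hlt d) (hcomp d) (hKrne d)
  obtain ⟨d₀, x₀, hx₀, x', hx', hsol⟩ := exists_isQVISolution_of_isCompact hDne hDconv hDcomp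
    f.continuous hKrne (fun d => (hKconv d).inter (convex_closedBall _ _)) hlsc hgraph hKDcomp hKC
    (fun d => Set.inter_subset_left.trans
      ((Set.subset_iUnion K d).trans (subset_convexHull ℝ _)))
    hFne hFconv hFcomp hFusc hFpm
  -- Testing with z = x₀, then with d = d₀, decouples the inequality; only the second part needs the
  -- truncation removed.
  refine ⟨d₀, x₀, hx₀.1, x', hx', fun d z hz => add_nonneg ?_ ?_⟩
  · simpa using hsol d x₀ hx₀
  · exact (hrd d₀).solution_of_truncated (hlt d₀) (hKconv d₀) hx₀ hx'
      (fun w hw => by simpa using hsol d₀ w hw) z hz
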